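/- Let $K$ be a field and let $H$ be a Hopf algebra over $K$ with comultiplication $\Delta$ (written $\Delta(h)=h_1\otimes h_2$), counit $\varepsilon$ and antipode $S$. Assume that (1) $H$ has an ad-invariant integral, i.e. there is a $K$-linear map $\lambda:H\to K$ with $h_1\lambda(h_2)=\lambda(h)1_H$, $\lambda(h_1xS(h_2))=\varepsilon(h)\lambda(x)$ and $\lambda(1_H)=1_K$ for all $h,x\in H$; (2) $H$ is formally smooth as a $K$-algebra, i.e. the $H$-bimodule $\Omega^1H=\ker(H\otimes_K H\to H)$, the kernel of the multiplication, is projective relative to the class of those morphisms of $H$-bimodules (with $K$ acting in the same way on both sides) that have a $K$-linear section. Let $\mathcal M$ be either the monoidal category $\mathfrak M^H$ of right $H$-comodules or the monoidal category ${}^H\mathfrak M^H$ of $H$-bicomodules, with tensor product $\otimes_K$ and the codiagonal coactions, and regard $H$ as an algebra in $\mathcal M$ via $\Delta$. Let $E$ be an algebra in $\mathcal M$ and let $\pi:E\to H$ be an algebra homomorphism in $\mathcal M$ (a $K$-algebra homomorphism that is a morphism of right comodules, respectively of bicomodules) which is surjective and whose kernel $I$ is nilpotent, i.e. $I^n=0$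 for some $n$. Then there is an algebra homomorphism $\sigma:H\to E$ in $\mathcal M$ with $\pi\circ\sigma=\mathrm{Id}_H$. In particular, for $\mathcal M={}^H\mathfrak M^H$ the section $\sigma$ is $H$-bicolinear. -/

import Mathlib

open scoped TensorProduct

namespace HopfSplit

universe u v w

/-! ### Bimodules over a `K`-algebra and formal smoothness -/

section FormalSmoothness

variable (K : Type u) (A : Type v) [Field K] [Ring A] [Algebra K A]

/-- `Ω¹A`, the kernel of the multiplication `A ⊗ A → A`. -/
def Omega : Type v := ↥(LinearMap.ker (LinearMap.mul' K A))

instance : AddCommGroup (Omega K A) :=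
  inferInstanceAs (AddCommGroup ↥(LinearMap.ker (LinearMap.mul' K A)))

instance : Module K (Omega K A) :=
  inferInstanceAs (Module K ↥(LinearMap.ker (LinearMap.mul' K A)))

/-- The inclusion `Ω¹A → A ⊗ A`. -/
def Omega.incl : Omega K A →ₗ[K] A ⊗[K] A := (LinearMap.ker (LinearMap.mul' K A)).subtype

variable {K A}

theorem Omega.incl_injective : Function.Injective (Omega.incl K A) := Subtype.val_injective

theorem mul'_rTensor_mulLeft (a : A) (t : A ⊗[K] A) :
    LinearMap.mul' K A ((LinearMap.mulLeft K a).rTensor A t) = a * LinearMap.mul' K A t := by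
  induction t with
  | zero => simp
  | tmul x y => simp [mul_assoc]
  | add x y hx hy => simp [hx, hy, mul_add]

theorem mul'_lTensor_mulRight (a : A) (t : A ⊗[K] A) :
    LinearMap.mul' K A ((LinearMap.mulRight K a).lTensor A t) = LinearMap.mul' K A t * a := by
  induction t with
  | zero => simp
  | tmul x y => simp [mul_assoc]
  | add x y hx hy => simp [hx, hy, add_mul]

/-- The left action `a • (∑ xᵢ ⊗ yᵢ) = ∑ a xᵢ ⊗ yᵢ` on `Ω¹A`. -/
instance : SMul A (Omega K A) where
  smul a t := ⟨(LinearMap.mulLeft K a).rTensor A (Omega.incl K A t), by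
    have h : LinearMap.mul' K A (Omega.incl K A t) = 0 := t.2
    rw [LinearMap.mem_ker, mul'_rTensor_mulLeft, h, mul_zero]⟩

/-- The right action `(∑ xᵢ ⊗ yᵢ) • a = ∑ xᵢ ⊗ yᵢ a` on `Ω¹A`. -/
instance : SMul Aᵐᵒᵖ (Omega K A) where
  smul a t := ⟨(LinearMap.mulRight K a.unop).lTensor A (Omega.incl K A t), by
    have h : LinearMap.mul' K A (Omega.incl K A t) = 0 := t.2
    rw [LinearMap.mem_ker, mul'_lTensor_mulRight, h, zero_mul]⟩

theorem Omega.incl_smul (a : A) (t : Omega K A) :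
    Omega.incl K A (a • t) = (LinearMap.mulLeft K a).rTensor A (Omega.incl K A t) := rfl

theorem Omega.incl_op_smul (a : Aᵐᵒᵖ) (t : Omega K A) :
    Omega.incl K A (a • t) = (LinearMap.mulRight K a.unop).lTensor A (Omega.incl K A t) := rfl

instance : Module A (Omega K A) where
  one_smul t := Omega.incl_injective (by simp [Omega.incl_smul])
  mul_smul a b t := Omega.incl_injective (by
    simp [Omega.incl_smul, LinearMap.mulLeft_mul, LinearMap.rTensor_comp])
  smul_zero a := Omega.incl_injective (by simp [Omega.incl_smul])
  smul_add a s t := Omega.incl_injective (by simp [Omega.incl_smul])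
  add_smul a b t := Omega.incl_injective (by
    have h : LinearMap.mulLeft K (a + b) = LinearMap.mulLeft K a + LinearMap.mulLeft K b := by
      ext x; simp [add_mul]
    simp [Omega.incl_smul, h, LinearMap.rTensor_add])
  zero_smul t := Omega.incl_injective (by simp [Omega.incl_smul])

instance : Module Aᵐᵒᵖ (Omega K A) where
  one_smul t := Omega.incl_injective (by simp [Omega.incl_op_smul])
  mul_smul a b t := Omega.incl_injective (by
    simp [Omega.incl_op_smul, LinearMap.mulRight_mul, LinearMap.lTensor_comp])
  smul_zero a := Omega.incl_injective (by simp [Omega.incl_op_smul])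
  smul_add a s t := Omega.incl_injective (by simp [Omega.incl_op_smul])
  add_smul a b t := Omega.incl_injective (by
    have h : LinearMap.mulRight K (a.unop + b.unop) =
        LinearMap.mulRight K a.unop + LinearMap.mulRight K b.unop := by
      ext x; simp [mul_add]
    simp [Omega.incl_op_smul, h, LinearMap.lTensor_add])
  zero_smul t := Omega.incl_injective (by simp [Omega.incl_op_smul])

variable (K A)

/-- `M` is an `A`-bimodule in the category of `K`-vector spaces: the two actions commute and both
restrict to the given action of `K`. -/
class IsBimodule (M : Type w) [AddCommGroup M] [Module K M] [Module A M] [Module Aᵐᵒᵖ M] :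
    Prop where
  smul_op_smul_comm : ∀ (a : A) (b : Aᵐᵒᵖ) (m : M), a • b • m = b • a • m
  algebraMap_smul : ∀ (k : K) (m : M), algebraMap K A k • m = k • m
  op_algebraMap_smul : ∀ (k : K) (m : M), MulOpposite.op (algebraMap K A k) • m = k • m

instance : IsBimodule K A (Omega K A) where
  smul_op_smul_comm a b t := Omega.incl_injective (by
    simp only [Omega.incl_smul, Omega.incl_op_smul]
    exact (DFunLike.congr_fun (LinearMap.rTensor_comp_lTensor _ _ _) _).trans
      (DFunLike.congr_fun (LinearMap.lTensor_comp_rTensor _ _ _) _).symm)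
  algebraMap_smul k t := Omega.incl_injective (by
    have h : LinearMap.mulLeft K (algebraMap K A k) = k • LinearMap.id := by
      ext x; simp [Algebra.smul_def]
    simp [Omega.incl_smul, h, LinearMap.rTensor_smul])
  op_algebraMap_smul k t := Omega.incl_injective (by
    have h : LinearMap.mulRight K (algebraMap K A k) = k • LinearMap.id := by
      ext x; simp [Algebra.smul_def, Algebra.commutes]
    simp [Omega.incl_op_smul, h, LinearMap.lTensor_smul])

variable {K}

/-- A `K`-linear map between `A`-bimodules is a morphism of `A`-bimodules. -/
structure IsBimoduleHom {M N : Type*} [AddCommGroup M] [Module K M] [Module A M] [Module Aᵐᵒᵖ M]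
    [AddCommGroup N] [Module K N] [Module A N] [Module Aᵐᵒᵖ N] (f : M →ₗ[K] N) : Prop where
  map_smul : ∀ (a : A) (m : M), f (a • m) = a • f m
  map_op_smul : ∀ (a : Aᵐᵒᵖ) (m : M), f (a • m) = a • f m

variable (K)

/-- `A` is formally smooth as a `K`-algebra: the bimodule `Ω¹A` is projective relative to the
bimodule morphisms `g : M → N` that have a `K`-linear section. -/
def IsFormallySmooth : Prop :=
  ∀ (M N : Type v) [AddCommGroup M] [Module K M] [Module A M] [Module Aᵐᵒᵖ M] [IsBimodule K A M]
    [AddCommGroup N] [Module K N] [Module A N] [Module Aᵐᵒᵖ N] [IsBimodule K A N]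
    (g : M →ₗ[K] N), IsBimoduleHom A g → (∃ s : N →ₗ[K] M, g ∘ₗ s = LinearMap.id) →
    ∀ f : Omega K A →ₗ[K] N, IsBimoduleHom A f →
      ∃ f' : Omega K A →ₗ[K] M, IsBimoduleHom A f' ∧ g ∘ₗ f' = f

end FormalSmoothness

/-! ### `ad`-invariant integrals -/

/-- `lam ∈ H*` is an `ad`-invariant integral:
`h₁ lam(h₂) = lam(h) 1`, `lam(h₁ x S(h₂)) = ε(h) lam(x)` and `lam(1) = 1`. -/
structure IsAdInvariantIntegral (K : Type u) {H : Type v} [Field K] [Ring H] [HopfAlgebra K H]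
    (lam : H →ₗ[K] K) : Prop where
  left_integral : ∀ h : H,
    TensorProduct.rid K H (lam.lTensor H (Coalgebra.comul (R := K) h)) = lam h • (1 : H)
  ad_invariant : ∀ h x : H,
    lam (LinearMap.mul' K H (TensorProduct.map (LinearMap.mulRight K x) (HopfAlgebra.antipode K)
      (Coalgebra.comul (R := K) h))) = Coalgebra.counit (R := K) h * lam x
  map_one : lam 1 = 1

/-! ### Comodules and comodule algebras -/

section Comodules

variable {K : Type u} {H : Type v} [Field K] [Ring H] [HopfAlgebra K H]

/-- `ρ : M → M ⊗ H` is a coassociative and counital right coaction. -/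
structure IsRightComodule {M : Type w} [AddCommGroup M] [Module K M] (ρ : M →ₗ[K] M ⊗[K] H) :
    Prop where
  coassoc : (TensorProduct.assoc K M H H).toLinearMap ∘ₗ ρ.rTensor H ∘ₗ ρ =
    (Coalgebra.comul (R := K) (A := H)).lTensor M ∘ₗ ρ
  counit : (TensorProduct.rid K M).toLinearMap ∘ₗ
    (Coalgebra.counit (R := K) (A := H)).lTensor M ∘ₗ ρ = LinearMap.id

/-- `δ : M → H ⊗ M` is a coassociative and counital left coaction. -/
structure IsLeftComodule {M : Type w} [AddCommGroup M] [Module K M] (δ : M →ₗ[K] H ⊗[K] M) :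
    Prop where
  coassoc : δ.lTensor H ∘ₗ δ =
    (TensorProduct.assoc K H H M).toLinearMap ∘ₗ
      (Coalgebra.comul (R := K) (A := H)).rTensor M ∘ₗ δ
  counit : (TensorProduct.lid K M).toLinearMap ∘ₗ
    (Coalgebra.counit (R := K) (A := H)).rTensor M ∘ₗ δ = LinearMap.id

/-- `(M, δ, ρ)` is an `H`-bicomodule: a left and a right comodule with commuting coactions. -/
structure IsBicomodule {M : Type w} [AddCommGroup M] [Module K M] (δ : M →ₗ[K] H ⊗[K] M)
    (ρ : M →ₗ[K] M ⊗[K] H) : Prop where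
  left : IsLeftComodule δ
  right : IsRightComodule ρ
  comm : (TensorProduct.assoc K H M H).toLinearMap ∘ₗ δ.rTensor H ∘ₗ ρ = ρ.lTensor H ∘ₗ δ

/-- `(E, ρ)` is an algebra in the monoidal category of right `H`-comodules. As the product of
`E ⊗ H` is `(x ⊗ h)(y ⊗ l) = xy ⊗ hl`, the condition `coact_mul` says that the multiplication
`E ⊗ E → E` is colinear for the codiagonal coaction `x ⊗ y ↦ x₀ ⊗ y₀ ⊗ x₁y₁`, and `coact_one` says
that the unit `K → E` is colinear. -/
structure IsRightComoduleAlgebra {E : Type w} [Ring E] [Algebra K E] (ρ : E →ₗ[K] E ⊗[K] H) :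
    Prop where
  comodule : IsRightComodule ρ
  coact_mul : ∀ x y : E, ρ (x * y) = ρ x * ρ y
  coact_one : ρ 1 = 1 ⊗ₜ[K] 1

/-- `(E, δ, ρ)` is an algebra in the monoidal category of `H`-bicomodules. -/
structure IsBicomoduleAlgebra {E : Type w} [Ring E] [Algebra K E] (δ : E →ₗ[K] H ⊗[K] E)
    (ρ : E →ₗ[K] E ⊗[K] H) : Prop where
  bicomodule : IsBicomodule δ ρ
  left_coact_mul : ∀ x y : E, δ (x * y) = δ x * δ y
  left_coact_one : δ 1 = 1 ⊗ₜ[K] 1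
  right_coact_mul : ∀ x y : E, ρ (x * y) = ρ x * ρ y
  right_coact_one : ρ 1 = 1 ⊗ₜ[K] 1

/-- `f` is a morphism of right comodules `(M, ρM) → (N, ρN)`. -/
def IsRightColinear {M N : Type*} [AddCommGroup M] [Module K M] [AddCommGroup N] [Module K N]
    (ρM : M →ₗ[K] M ⊗[K] H) (ρN : N →ₗ[K] N ⊗[K] H) (f : M →ₗ[K] N) : Prop :=
  ρN ∘ₗ f = f.rTensor H ∘ₗ ρM

/-- `f` is a morphism of left comodules `(M, δM) → (N, δN)`. -/
def IsLeftColinear {M N : Type*} [AddCommGroup M] [Module K M] [AddCommGroup N] [Module K N]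
    (δM : M →ₗ[K] H ⊗[K] M) (δN : N →ₗ[K] H ⊗[K] N) (f : M →ₗ[K] N) : Prop :=
  δN ∘ₗ f = f.lTensor H ∘ₗ δM

end Comodules

end HopfSplit

/-! Write `I` for the kernel of `π`. The section is found by Newton's method: a unital linear
section is corrected so that its curvature `σ(ab) - σ(a)σ(b)` moves from `I ^ (k + 1)` into `I ^ (k
+ 2)`, until nilpotency kills it. Formal smoothness, used once, gives a derivation `D : H → H ⊗ H ⊗
H` lifting the universal one along the bar differential (`IsFormallySmooth.exists_derivation`);
feeding `D` into the curvature yields every correction (`exists_newton_step`).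

A correction need not be colinear, and the integral repairs this. With `θ(g ⊗ h) = λ(g S(h))`, the
map `n ⊗ h ↦ n₀ θ(n₁ ⊗ h)` is a colinear retraction of the coaction, so every linear map has a
colinear average (`coaction_average`). Averaging is not multiplicative. But `θ` is invariant under
multiplication by `Δ(a)` on both sides, so the retraction is `E`-bilinear, and the error made is
quadratic in the distance to a colinear map (`average_mul_sub_mem`). Near the previous colinear
section that distance lies in `I ^ (k + 1)`, so the error lies in `I ^ (k + 2)` and costs nothing.

For bicomodules, the left coaction is a right coaction of the co-opposite bialgebra, for which the
flipped form is again invariant. As the two coactions commute, averaging on the left keeps the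
colinearity already obtained on the right. -/

open scoped TensorProduct

namespace HopfSplit

/-! ### Invariant forms and the colinear retraction of a coaction -/

section Averaging

variable {K H E : Type*} [Field K] [Ring H] [Algebra K H] [Ring E] [Algebra K E]

/-- A form on a bialgebra that exhibits it as a coseparable coalgebra and is invariant under
multiplication on both sides. -/
structure IsInvariantForm (Δ : H →ₐ[K] H ⊗[K] H) (ε : H →ₗ[K] K) (θ : H ⊗[K] H →ₗ[K] K) :
    Prop where
  cosep : ∀ g h : H, TensorProduct.rid K H
      ((θ ∘ₗ (TensorProduct.mk K H H).flip h).lTensor H (Δ g)) =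
    TensorProduct.lid K H ((θ ∘ₗ TensorProduct.mk K H H g).rTensor H (Δ h))
  comul : ∀ h : H, θ (Δ h) = ε h
  comul_mul : ∀ (a : H) (t : H ⊗[K] H), θ (Δ a * t) = ε a * θ t
  mul_comul : ∀ (t : H ⊗[K] H) (a : H), θ (t * Δ a) = θ t * ε a

/-- A coassociative and counital right coaction by an algebra homomorphism. -/
structure IsAlgCoaction (Δ : H →ₐ[K] H ⊗[K] H) (ε : H →ₗ[K] K) (ρ : E →ₐ[K] E ⊗[K] H) :
    Prop where
  coassoc : ∀ x : E, TensorProduct.assoc K E H H (ρ.toLinearMap.rTensor H (ρ x)) =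
    Δ.toLinearMap.lTensor E (ρ x)
  counit : ∀ x : E, TensorProduct.rid K E (ε.lTensor E (ρ x)) = x

/-- The retraction `n ⊗ h ↦ n₀ θ(n₁ ⊗ h)` of a coaction `ρ`. -/
noncomputable def retraction (θ : H ⊗[K] H →ₗ[K] K) (ρ : E →ₐ[K] E ⊗[K] H) :
    E ⊗[K] H →ₗ[K] E :=
  (TensorProduct.rid K E).toLinearMap ∘ₗ θ.lTensor E ∘ₗ
    (TensorProduct.assoc K E H H).toLinearMap ∘ₗ ρ.toLinearMap.rTensor H

theorem retraction_apply (θ : H ⊗[K] H →ₗ[K] K) (ρ : E →ₐ[K] E ⊗[K] H) (t : E ⊗[K] H) :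
    retraction θ ρ t = TensorProduct.rid K E (θ.lTensor E
      (TensorProduct.assoc K E H H (ρ.toLinearMap.rTensor H t))) := rfl

theorem retraction_tmul (θ : H ⊗[K] H →ₗ[K] K) (ρ : E →ₐ[K] E ⊗[K] H) (n : E) (h : H) :
    retraction θ ρ (n ⊗ₜ h) = TensorProduct.rid K E
      ((θ ∘ₗ (TensorProduct.mk K H H).flip h).lTensor E (ρ n)) := by
  rw [retraction_apply]
  simp only [LinearMap.rTensor_tmul, AlgHom.toLinearMap_apply]
  induction ρ n with
  | zero => simp
  | tmul x y => simp
  | add x y hx hy => simp only [TensorProduct.add_tmul, map_add, hx, hy]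

theorem assoc_rTensor_mul (ρ : E →ₐ[K] E ⊗[K] H) (s t : E ⊗[K] H) :
    TensorProduct.assoc K E H H (ρ.toLinearMap.rTensor H (s * t)) =
      TensorProduct.assoc K E H H (ρ.toLinearMap.rTensor H s) *
        TensorProduct.assoc K E H H (ρ.toLinearMap.rTensor H t) :=
  map_mul ((Algebra.TensorProduct.assoc K K K E H H).toAlgHom.comp
    (Algebra.TensorProduct.map ρ (AlgHom.id K H))) s t

variable {Δ : H →ₐ[K] H ⊗[K] H} {ε : H →ₗ[K] K} {θ : H ⊗[K] H →ₗ[K] K}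
  {ρ : E →ₐ[K] E ⊗[K] H}

/-- Coassociativity turns the left side into `x₀ θ(Δ(x₁))`, and `θ ∘ Δ = ε`. -/
theorem retraction_coaction (hθ : IsInvariantForm Δ ε θ) (hρ : IsAlgCoaction Δ ε ρ) (x : E) :
    retraction θ ρ (ρ x) = x := by
  have h : θ ∘ₗ Δ.toLinearMap = ε := LinearMap.ext hθ.comul
  rw [retraction_apply, hρ.coassoc, ← LinearMap.comp_apply, ← LinearMap.lTensor_comp, h,
    hρ.counit]

/-- With the next lemma: the retraction is `E`-bilinear when `E` acts on `E ⊗ H` through `ρ`. By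
coassociativity the factor reaching `θ` is `Δ(x₁)`, which invariance replaces by `ε(x₁)`. -/
theorem retraction_coaction_mul (hθ : IsInvariantForm Δ ε θ) (hρ : IsAlgCoaction Δ ε ρ) (x : E)
    (t : E ⊗[K] H) : retraction θ ρ (ρ x * t) = x * retraction θ ρ t := by
  have key : ∀ (y : E ⊗[K] H) (u : E ⊗[K] (H ⊗[K] H)),
      TensorProduct.rid K E (θ.lTensor E (Δ.toLinearMap.lTensor E y * u)) =
        TensorProduct.rid K E (ε.lTensor E y) * TensorProduct.rid K E (θ.lTensor E u) := by
    intro y u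
    induction y with
    | zero => simp
    | add y z hy hz => simp only [map_add, add_mul, hy, hz]
    | tmul e a =>
      induction u with
      | zero => simp
      | add u v hu hv => simp only [map_add, mul_add, hu, hv]
      | tmul n v => simp [hθ.comul_mul, smul_smul, mul_comm]
  rw [retraction_apply, assoc_rTensor_mul, hρ.coassoc, key, hρ.counit, ← retraction_apply]

theorem retraction_mul_coaction (hθ : IsInvariantForm Δ ε θ) (hρ : IsAlgCoaction Δ ε ρ) (x : E)
    (t : E ⊗[K] H) : retraction θ ρ (t * ρ x) = retraction θ ρ t * x := by
  have key : ∀ (y : E ⊗[K] H) (u : E ⊗[K] (H ⊗[K] H)),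
      TensorProduct.rid K E (θ.lTensor E (u * Δ.toLinearMap.lTensor E y)) =
        TensorProduct.rid K E (θ.lTensor E u) * TensorProduct.rid K E (ε.lTensor E y) := by
    intro y u
    induction y with
    | zero => simp
    | add y z hy hz => simp only [map_add, mul_add, hy, hz]
    | tmul e a =>
      induction u with
      | zero => simp
      | add u v hu hv => simp only [map_add, add_mul, hu, hv]
      | tmul n v => simp [hθ.mul_comul, smul_smul, mul_comm]
  rw [retraction_apply, assoc_rTensor_mul, hρ.coassoc, key, hρ.counit, ← retraction_apply]

/-- The retraction is colinear for the coaction `id ⊗ Δ` of `E ⊗ H`. -/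
theorem coaction_retraction (hθ : IsInvariantForm Δ ε θ) (hρ : IsAlgCoaction Δ ε ρ)
    (t : E ⊗[K] H) : ρ (retraction θ ρ t) = (retraction θ ρ).rTensor H
      ((TensorProduct.assoc K E H H).symm (Δ.toLinearMap.lTensor E t)) := by
  induction t with
  | zero => simp
  | add s t hs ht => simp only [map_add, hs, ht]
  | tmul n h =>
    -- Coassociativity makes the left side `n₀ ⊗ n₁ θ(n₂ ⊗ h)`, while the right side is `n₀ ⊗ θ(n₁ ⊗
    -- h₁) h₂`. Coseparability identifies the second legs.
    have h1 : ∀ (φ : H →ₗ[K] K) (y : E ⊗[K] H), ρ (TensorProduct.rid K E (φ.lTensor E y)) =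
        ((TensorProduct.rid K H).toLinearMap ∘ₗ φ.lTensor H).lTensor E
          (TensorProduct.assoc K E H H (ρ.toLinearMap.rTensor H y)) := by
      intro φ y
      induction y with
      | zero => simp
      | add y z hy hz => simp only [map_add, hy, hz]
      | tmul e a =>
        simp only [LinearMap.lTensor_tmul, TensorProduct.rid_tmul, map_smul,
          LinearMap.rTensor_tmul, AlgHom.toLinearMap_apply]
        induction ρ e with
        | zero => simp
        | add y z hy hz => simp only [TensorProduct.add_tmul, map_add, smul_add, hy, hz]
        | tmul e b => simp
    have h2 : ∀ w : H ⊗[K] H, (retraction θ ρ).rTensor H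
        ((TensorProduct.assoc K E H H).symm (n ⊗ₜ w)) =
        (((TensorProduct.lid K H).toLinearMap ∘ₗ θ.rTensor H ∘ₗ
          (TensorProduct.assoc K H H H).symm.toLinearMap) ∘ₗ
            (TensorProduct.mk K H (H ⊗[K] H)).flip w).lTensor E (ρ n) := by
      intro w
      induction w with
      | zero => simp
      | add v w hv hw =>
        simp only [TensorProduct.tmul_add, map_add, LinearMap.comp_add, LinearMap.lTensor_add,
          LinearMap.add_apply, hv, hw]
      | tmul a b =>
        simp only [TensorProduct.assoc_symm_tmul, LinearMap.rTensor_tmul, retraction_tmul]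
        induction ρ n with
        | zero => simp
        | add y z hy hz => simp only [TensorProduct.add_tmul, map_add, hy, hz]
        | tmul e c => simp [TensorProduct.smul_tmul]
    have h3 : ∀ (g : H) (w : H ⊗[K] H), TensorProduct.lid K H (θ.rTensor H
        ((TensorProduct.assoc K H H H).symm (g ⊗ₜ w))) =
        TensorProduct.lid K H ((θ ∘ₗ TensorProduct.mk K H H g).rTensor H w) := by
      intro g w
      induction w with
      | zero => simp
      | add v w hv hw => simp only [TensorProduct.tmul_add, map_add, hv, hw]
      | tmul a b => simp
    rw [retraction_tmul, h1, hρ.coassoc, LinearMap.lTensor_tmul, h2, ← LinearMap.comp_apply,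
      ← LinearMap.lTensor_comp]
    congr 2
    ext g
    simpa [h3] using hθ.cosep g h

/-! #### Submodules stable under a coaction -/

/-- The image of `W ⊗ H` in `E ⊗ H`. -/
def tensorRight (H : Type*) [Ring H] [Algebra K H] (W : Submodule K E) :
    Submodule K (E ⊗[K] H) :=
  Submodule.map₂ (TensorProduct.mk K E H) W ⊤

theorem tmul_mem_tensorRight {W : Submodule K E} {w : E} (hw : w ∈ W) (h : H) :
    w ⊗ₜ[K] h ∈ tensorRight H W :=
  Submodule.apply_mem_map₂ _ hw Submodule.mem_top

theorem rTensor_mem_tensorRight {M : Type*} [AddCommGroup M] [Module K M] {W : Submodule K E}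
    {f : M →ₗ[K] E} (hf : ∀ m, f m ∈ W) (t : M ⊗[K] H) : f.rTensor H t ∈ tensorRight H W := by
  induction t with
  | zero => simp
  | add s t hs ht => rw [map_add]; exact add_mem hs ht
  | tmul m h => exact tmul_mem_tensorRight (hf m) h

theorem mul_mem_tensorRight {V W : Submodule K E} {s t : E ⊗[K] H} (hs : s ∈ tensorRight H V)
    (ht : t ∈ tensorRight H W) : s * t ∈ tensorRight H (V * W) := by
  suffices h : tensorRight H V ≤ (tensorRight H (V * W)).comap (LinearMap.mulRight K t) from h hs
  refine Submodule.map₂_le.2 fun v hv a _ => ?_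
  suffices h : tensorRight H W ≤
    (tensorRight H (V * W)).comap (LinearMap.mulLeft K (v ⊗ₜ[K] a)) from h ht
  refine Submodule.map₂_le.2 fun w hw b _ => ?_
  simpa using tmul_mem_tensorRight (Submodule.mul_mem_mul hv hw) (a * b)

/-- Only stability of `W` matters here: the retraction of `n ⊗ h` is a combination of the left legs
of `ρ n`. -/
theorem retraction_mem {W : Submodule K E} (hW : ∀ w ∈ W, ρ w ∈ tensorRight H W) {t : E ⊗[K] H}
    (ht : t ∈ tensorRight H W) : retraction θ ρ t ∈ W := by
  suffices h : tensorRight H W ≤ W.comap (retraction θ ρ) from h ht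
  refine Submodule.map₂_le.2 fun n hn h _ => ?_
  rw [TensorProduct.mk_apply, Submodule.mem_comap, retraction_tmul]
  suffices h' : tensorRight H W ≤ W.comap ((TensorProduct.rid K E).toLinearMap ∘ₗ
    (θ ∘ₗ (TensorProduct.mk K H H).flip h).lTensor E) from h' (hW n hn)
  refine Submodule.map₂_le.2 fun m hm g _ => ?_
  simpa using W.smul_mem _ hm

theorem coaction_pow_mem {I : Submodule K E} (hI : ∀ x ∈ I, ρ x ∈ tensorRight H I) (n : ℕ) :
    ∀ x ∈ I ^ n, ρ x ∈ tensorRight H (I ^ n) := by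
  induction n with
  | zero =>
    intro x hx
    -- Powers are those of `K`-submodules, so the zeroth power is the line `K · 1` and not the whole
    -- algebra.
    obtain ⟨c, rfl⟩ := Submodule.mem_one.1 (by simpa using hx)
    rw [AlgHom.commutes, Algebra.algebraMap_eq_smul_one, Algebra.TensorProduct.one_def]
    exact Submodule.smul_mem _ _ (tmul_mem_tensorRight (by
      rw [pow_zero]; exact Submodule.one_le.1 le_rfl) 1)
  | succ n ih =>
    intro x hx
    rw [pow_succ] at hx ⊢
    suffices h : I ^ n * I ≤ (tensorRight H (I ^ n * I)).comap ρ.toLinearMap from h hx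
    refine Submodule.mul_le.2 fun y hy z hz => ?_
    rw [Submodule.mem_comap, AlgHom.toLinearMap_apply, map_mul]
    exact mul_mem_tensorRight (ih y hy) (hI z hz)

/-- Colinearity puts `ρ x` in the kernel of `π ⊗ H`, which right exactness of the tensor product
identifies with the image of `ker π ⊗ H`. -/
theorem coaction_ker_mem {π : E →ₐ[K] H} (hsurj : Function.Surjective π)
    (hπ : ∀ x, Δ (π x) = π.toLinearMap.rTensor H (ρ x)) :
    ∀ x ∈ LinearMap.ker π.toLinearMap, ρ x ∈ tensorRight H (LinearMap.ker π.toLinearMap) := by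
  intro x hx
  have h1 : π.toLinearMap.rTensor H (ρ x) = 0 := by
    rw [← hπ]
    have : π x = 0 := hx
    simp [this]
  obtain ⟨t, ht⟩ := (rTensor_exact H (LinearMap.exact_subtype_ker_map π.toLinearMap)
    hsurj (ρ x)).1 h1
  rw [← ht]
  exact rTensor_mem_tensorRight (fun m => m.2) t

/-! #### Averaging -/

/-- The average `h ↦ f(h₁)₀ θ(f(h₁)₁ ⊗ h₂)` of a linear map `f`. -/
noncomputable def average (Δ : H →ₐ[K] H ⊗[K] H) (θ : H ⊗[K] H →ₗ[K] K) (ρ : E →ₐ[K] E ⊗[K] H)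
    (f : H →ₗ[K] E) : H →ₗ[K] E :=
  retraction θ ρ ∘ₗ f.rTensor H ∘ₗ Δ.toLinearMap

theorem average_apply (f : H →ₗ[K] E) (h : H) :
    average Δ θ ρ f h = retraction θ ρ (f.rTensor H (Δ h)) := rfl

/-- The average is a composite of colinear maps `H → H ⊗ H → E ⊗ H → E`, where `H` coacts on the
tensor products through the last factor; `Δ` is colinear by coassociativity. -/
theorem coaction_average (hθ : IsInvariantForm Δ ε θ) (hρ : IsAlgCoaction Δ ε ρ)
    (hΔ : IsAlgCoaction Δ ε Δ) (f : H →ₗ[K] E) (h : H) :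
    ρ (average Δ θ ρ f h) = (average Δ θ ρ f).rTensor H (Δ h) := by
  have h1 : ∀ t : H ⊗[K] H, (TensorProduct.assoc K E H H).symm
      (Δ.toLinearMap.lTensor E (f.rTensor H t)) = (f.rTensor H).rTensor H
      ((TensorProduct.assoc K H H H).symm (Δ.toLinearMap.lTensor H t)) := by
    intro t
    induction t with
    | zero => simp
    | add s t hs ht => simp only [map_add, hs, ht]
    | tmul a b =>
      simp only [LinearMap.rTensor_tmul, LinearMap.lTensor_tmul, AlgHom.toLinearMap_apply]
      induction Δ b with
      | zero => simp
      | add y z hy hz => simp only [TensorProduct.tmul_add, map_add, hy, hz]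
      | tmul c d => simp
  rw [average_apply, coaction_retraction hθ hρ, h1, ← hΔ.coassoc, LinearEquiv.symm_apply_apply]
  simp only [average, LinearMap.rTensor_comp, LinearMap.comp_apply]

theorem average_of_colinear (hθ : IsInvariantForm Δ ε θ) (hρ : IsAlgCoaction Δ ε ρ)
    {f : H →ₗ[K] E} (hf : ∀ h, ρ (f h) = f.rTensor H (Δ h)) (h : H) :
    average Δ θ ρ f h = f h := by
  rw [average_apply, ← hf, retraction_coaction hθ hρ]

theorem average_one (hθ : IsInvariantForm Δ ε θ) (hρ : IsAlgCoaction Δ ε ρ) {f : H →ₗ[K] E}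
    (hf : f 1 = 1) : average Δ θ ρ f 1 = 1 := by
  have h1 : f.rTensor H (Δ 1) = ρ 1 := by
    rw [map_one Δ, map_one ρ, Algebra.TensorProduct.one_def, LinearMap.rTensor_tmul, hf,
      Algebra.TensorProduct.one_def]
  rw [average_apply, h1, retraction_coaction hθ hρ]

theorem average_mem {W : Submodule K E} (hW : ∀ w ∈ W, ρ w ∈ tensorRight H W) {f : H →ₗ[K] E}
    (hf : ∀ h, f h ∈ W) (h : H) : average Δ θ ρ f h ∈ W :=
  retraction_mem hW (rTensor_mem_tensorRight hf _)

/-- Averaging is linear, fixes the colinear `σ`, and preserves values in a stable submodule. -/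
theorem average_sub_mem (hθ : IsInvariantForm Δ ε θ) (hρ : IsAlgCoaction Δ ε ρ)
    {V : Submodule K E} (hV : ∀ v ∈ V, ρ v ∈ tensorRight H V) {σ f : H →ₗ[K] E}
    (hσ : ∀ h, ρ (σ h) = σ.rTensor H (Δ h)) (hf : ∀ h, f h - σ h ∈ V) (h : H) :
    average Δ θ ρ f h - σ h ∈ V := by
  have h1 := average_mem (Δ := Δ) (θ := θ) hV (f := f - σ) hf h
  rwa [average_apply, LinearMap.rTensor_sub, LinearMap.sub_apply, map_sub, ← average_apply,
    ← average_apply, average_of_colinear hθ hρ hσ] at h1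

theorem map_retraction {π : E →ₐ[K] H} (hπ : ∀ x, Δ (π x) = π.toLinearMap.rTensor H (ρ x))
    (t : E ⊗[K] H) : π (retraction θ ρ t) = retraction θ Δ (π.toLinearMap.rTensor H t) := by
  induction t with
  | zero => simp
  | add s t hs ht => simp only [map_add, hs, ht]
  | tmul n h =>
    rw [LinearMap.rTensor_tmul, retraction_tmul, retraction_tmul, AlgHom.toLinearMap_apply, hπ]
    induction ρ n with
    | zero => simp
    | add y z hy hz => simp only [map_add, hy, hz]
    | tmul e a => simp

/-- By colinearity `π` intertwines the retractions of `E` and `H`, so it sends the average of `f` to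
the average of `π ∘ f = id`, which is `id`. -/
theorem map_average (hθ : IsInvariantForm Δ ε θ) (hΔ : IsAlgCoaction Δ ε Δ) {π : E →ₐ[K] H}
    (hπ : ∀ x, Δ (π x) = π.toLinearMap.rTensor H (ρ x)) {f : H →ₗ[K] E}
    (hf : ∀ h, π (f h) = h) (h : H) : π (average Δ θ ρ f h) = h := by
  have h1 : π.toLinearMap ∘ₗ f = LinearMap.id := LinearMap.ext hf
  rw [average_apply, map_retraction hπ, ← LinearMap.rTensor_comp_apply, h1,
    LinearMap.rTensor_id, LinearMap.id_apply, retraction_coaction hθ hΔ]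

/-- Averaging preserves multiplicativity modulo `W`, provided that the map differs from a colinear
map by values in some `V` with `V * V ≤ W`. -/
theorem average_mul_sub_mem (hθ : IsInvariantForm Δ ε θ) (hρ : IsAlgCoaction Δ ε ρ)
    {V W : Submodule K E} (hV : ∀ v ∈ V, ρ v ∈ tensorRight H V)
    (hW : ∀ w ∈ W, ρ w ∈ tensorRight H W) (hVW : V * V ≤ W) {σ f : H →ₗ[K] E}
    (hσ : ∀ h, ρ (σ h) = σ.rTensor H (Δ h)) (hf : ∀ h, f h - σ h ∈ V)
    (hmul : ∀ a b, f (a * b) - f a * f b ∈ W) (a b : H) :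
    average Δ θ ρ f (a * b) - average Δ θ ρ f a * average Δ θ ρ f b ∈ W := by
  set g : H →ₗ[K] E := f - σ
  have hg : ∀ h, g h ∈ V := hf
  have hfg : f = σ + g := by simp [g]
  have hav : ∀ h, average Δ θ ρ f h = σ h + average Δ θ ρ g h := by
    intro h
    rw [← average_of_colinear hθ hρ hσ h, average_apply, average_apply, average_apply, hfg,
      LinearMap.rTensor_add, LinearMap.add_apply, map_add]
  -- The curvature of `f ⊗ id` is that of `f` on the first legs, since `id` is multiplicative.
  have h1 : ∀ s t : H ⊗[K] H,
      f.rTensor H (s * t) - f.rTensor H s * f.rTensor H t ∈ tensorRight H W := by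
    intro s t
    induction s with
    | zero => simp
    | add s s' hs hs' =>
      have : f.rTensor H ((s + s') * t) - f.rTensor H (s + s') * f.rTensor H t =
        (f.rTensor H (s * t) - f.rTensor H s * f.rTensor H t) +
        (f.rTensor H (s' * t) - f.rTensor H s' * f.rTensor H t) := by
          simp only [add_mul, map_add]; abel
      rw [this]
      exact add_mem hs hs'
    | tmul x y =>
      induction t with
      | zero => simp
      | add t t' ht ht' =>
        have : f.rTensor H (x ⊗ₜ y * (t + t')) - f.rTensor H (x ⊗ₜ y) * f.rTensor H (t + t') =
          (f.rTensor H (x ⊗ₜ y * t) - f.rTensor H (x ⊗ₜ y) * f.rTensor H t) +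
          (f.rTensor H (x ⊗ₜ y * t') - f.rTensor H (x ⊗ₜ y) * f.rTensor H t') := by
            simp only [mul_add, map_add]; abel
        rw [this]
        exact add_mem ht ht'
      | tmul z w =>
        simp only [Algebra.TensorProduct.tmul_mul_tmul, LinearMap.rTensor_tmul,
          ← TensorProduct.sub_tmul]
        exact tmul_mem_tensorRight (hmul x z) _
  have hρf : ∀ h, f.rTensor H (Δ h) = ρ (σ h) + g.rTensor H (Δ h) := by
    intro h
    rw [hfg, LinearMap.rTensor_add, LinearMap.add_apply, hσ]
  have hmem : ∀ h, g.rTensor H (Δ h) ∈ tensorRight H V := fun h => rTensor_mem_tensorRight hg _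
  have hle : tensorRight H (V * V) ≤ tensorRight H W := Submodule.map₂_le_map₂_left hVW
  have h2 := retraction_mem (θ := θ) hW (h1 (Δ a) (Δ b))
  have h3 := retraction_mem (θ := θ) hW (hle (mul_mem_tensorRight (hmem a) (hmem b)))
  have h4 : average Δ θ ρ g a * average Δ θ ρ g b ∈ W :=
    hVW (Submodule.mul_mem_mul (average_mem hV hg a) (average_mem hV hg b))
  -- Expanding with `f = σ + g`, every product with a factor `ρ (σ _)` passes through the retraction
  -- by bilinearity. Only the term quadratic in `g` does not; it and the product of the averages of
  -- `g` both lie in `W` because `V * V ≤ W`.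
  have h5 : retraction θ ρ (f.rTensor H (Δ a * Δ b) - f.rTensor H (Δ a) * f.rTensor H (Δ b)) =
      average Δ θ ρ f (a * b) - (σ a * σ b + σ a * average Δ θ ρ g b + average Δ θ ρ g a * σ b +
        retraction θ ρ (g.rTensor H (Δ a) * g.rTensor H (Δ b))) := by
    rw [← map_mul, map_sub, average_apply, hρf a, hρf b, add_mul, mul_add, mul_add]
    simp only [map_add, retraction_coaction_mul hθ hρ, retraction_mul_coaction hθ hρ,
      retraction_coaction hθ hρ, ← average_apply]
    abel
  rw [h5] at h2
  have h6 := sub_mem (add_mem h2 h3) h4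
  convert h6 using 1
  rw [hav a, hav b]
  noncomm_ring

end Averaging
end HopfSplit

namespace HopfSplit

universe u v

/-! ### The bar differential and formal smoothness -/

section Bar

variable (K : Type u) (A : Type v) [Field K] [Ring A] [Algebra K A]

/-- The bimodule `A ⊗ A ⊗ A`, with `A` acting on the outer factors. -/
def TripleTensor : Type v := A ⊗[K] (A ⊗[K] A)

noncomputable instance : AddCommGroup (TripleTensor K A) :=
  inferInstanceAs (AddCommGroup (A ⊗[K] (A ⊗[K] A)))

noncomputable instance : Module K (TripleTensor K A) :=
  inferInstanceAs (Module K (A ⊗[K] (A ⊗[K] A)))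

/-- Left multiplication on the first factor of `A ⊗ A ⊗ A`. -/
noncomputable def leftMulTriple (a : A) : A ⊗[K] (A ⊗[K] A) →ₗ[K] A ⊗[K] (A ⊗[K] A) :=
  (LinearMap.mulLeft K a).rTensor (A ⊗[K] A)

/-- Right multiplication on the last factor of `A ⊗ A ⊗ A`. -/
noncomputable def rightMulTriple (a : A) : A ⊗[K] (A ⊗[K] A) →ₗ[K] A ⊗[K] (A ⊗[K] A) :=
  ((LinearMap.mulRight K a).lTensor A).lTensor A

variable {A}

@[simp] theorem leftMulTriple_tmul (a x : A) (y : A ⊗[K] A) :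
    leftMulTriple K A a (x ⊗ₜ y) = (a * x) ⊗ₜ y := rfl

@[simp] theorem rightMulTriple_tmul (a x y z : A) :
    rightMulTriple K A a (x ⊗ₜ (y ⊗ₜ z)) = x ⊗ₜ (y ⊗ₜ (z * a)) := rfl

noncomputable instance : SMul A (TripleTensor K A) := ⟨fun a => leftMulTriple K A a⟩

noncomputable instance : SMul Aᵐᵒᵖ (TripleTensor K A) := ⟨fun a => rightMulTriple K A a.unop⟩

theorem TripleTensor.smul_def (a : A) (t : TripleTensor K A) : a • t = leftMulTriple K A a t := rfl

theorem TripleTensor.op_smul_def (a : Aᵐᵒᵖ) (t : TripleTensor K A) :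
    a • t = rightMulTriple K A a.unop t := rfl

noncomputable instance : Module A (TripleTensor K A) where
  one_smul t := by
    rw [TripleTensor.smul_def, leftMulTriple, LinearMap.mulLeft_one, LinearMap.rTensor_id]; rfl
  mul_smul a b t := by
    simp only [TripleTensor.smul_def, leftMulTriple, LinearMap.mulLeft_mul,
      LinearMap.rTensor_comp]; rfl
  smul_zero a := map_zero (leftMulTriple K A a)
  smul_add a := map_add (leftMulTriple K A a)
  add_smul a b t := by
    have h : LinearMap.mulLeft K (a + b) = LinearMap.mulLeft K a + LinearMap.mulLeft K b := by
      ext x; simp [add_mul]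
    simp only [TripleTensor.smul_def, leftMulTriple, h, LinearMap.rTensor_add]; rfl
  zero_smul t := by
    have h : LinearMap.mulLeft K (0 : A) = 0 := by ext x; simp
    simp only [TripleTensor.smul_def, leftMulTriple, h, LinearMap.rTensor_zero]; rfl

noncomputable instance : Module Aᵐᵒᵖ (TripleTensor K A) where
  one_smul t := by
    rw [TripleTensor.op_smul_def, rightMulTriple, MulOpposite.unop_one, LinearMap.mulRight_one,
      LinearMap.lTensor_id, LinearMap.lTensor_id]; rfl
  mul_smul a b t := by
    simp only [TripleTensor.op_smul_def, rightMulTriple, MulOpposite.unop_mul,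
      LinearMap.mulRight_mul, LinearMap.lTensor_comp]; rfl
  smul_zero a := map_zero (rightMulTriple K A a.unop)
  smul_add a := map_add (rightMulTriple K A a.unop)
  add_smul a b t := by
    have h : LinearMap.mulRight K (a.unop + b.unop) =
        LinearMap.mulRight K a.unop + LinearMap.mulRight K b.unop := by
      ext x; simp [mul_add]
    simp only [TripleTensor.op_smul_def, rightMulTriple, MulOpposite.unop_add, h,
      LinearMap.lTensor_add]; rfl
  zero_smul t := by
    have h : LinearMap.mulRight K (0 : A) = 0 := by ext x; simp
    simp only [TripleTensor.op_smul_def, rightMulTriple, MulOpposite.unop_zero, h,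
      LinearMap.lTensor_zero]; rfl

instance : IsBimodule K A (TripleTensor K A) where
  smul_op_smul_comm a b t := by
    simp only [TripleTensor.op_smul_def, TripleTensor.smul_def]
    exact (DFunLike.congr_fun (LinearMap.rTensor_comp_lTensor _ _ _) _).trans
      (DFunLike.congr_fun (LinearMap.lTensor_comp_rTensor _ _ _) _).symm
  algebraMap_smul k t := by
    have h : LinearMap.mulLeft K (algebraMap K A k) = k • LinearMap.id := by
      ext x; simp [Algebra.smul_def]
    simp only [TripleTensor.smul_def, leftMulTriple, h, LinearMap.rTensor_smul,
      LinearMap.rTensor_id]; rfl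
  op_algebraMap_smul k t := by
    have h : LinearMap.mulRight K (algebraMap K A k) = k • LinearMap.id := by
      ext x; simp [Algebra.smul_def, Algebra.commutes]
    simp only [TripleTensor.op_smul_def, rightMulTriple, MulOpposite.unop_op, h,
      LinearMap.lTensor_smul, LinearMap.lTensor_id]; rfl

variable (A)

/-- The differential `x ⊗ y ⊗ z ↦ x ⊗ yz - xy ⊗ z` of the bar complex. -/
noncomputable def barDiff : A ⊗[K] (A ⊗[K] A) →ₗ[K] A ⊗[K] A :=
  (LinearMap.mul' K A).lTensor A -
    (LinearMap.mul' K A).rTensor A ∘ₗ (TensorProduct.assoc K A A A).symm.toLinearMap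

variable {A}

@[simp] theorem barDiff_tmul (x y z : A) :
    barDiff K A (x ⊗ₜ (y ⊗ₜ z)) = x ⊗ₜ (y * z) - (x * y) ⊗ₜ z := by
  simp [barDiff]

/-- Formal smoothness provides a derivation `A → A ⊗ A ⊗ A` lifting the universal derivation
`a ↦ 1 ⊗ a - a ⊗ 1` along the bar differential. -/
theorem IsFormallySmooth.exists_derivation (h : IsFormallySmooth K A) :
    ∃ D : A →ₗ[K] A ⊗[K] (A ⊗[K] A),
      (∀ a b, D (a * b) = leftMulTriple K A a (D b) + rightMulTriple K A b (D a)) ∧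
      ∀ a, barDiff K A (D a) = 1 ⊗ₜ a - a ⊗ₜ 1 := by
  have mul_barDiff : ∀ t, LinearMap.mul' K A (barDiff K A t) = 0 := by
    intro t
    have : LinearMap.mul' K A ∘ₗ barDiff K A = 0 := by ext x y z; simp [mul_assoc]
    exact DFunLike.congr_fun this t
  let g : TripleTensor K A →ₗ[K] Omega K A := (barDiff K A).codRestrict _ mul_barDiff
  have hgi : ∀ t, Omega.incl K A (g t) = barDiff K A t := fun _ => rfl
  -- The section is `w ↦ w ⊗ 1`: the bar differential sends `w ⊗ 1` to `w - mul(w) ⊗ 1`, and `mul(w)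
  -- = 0` on `Ω¹A`. It is only required to be `K`-linear.
  let s : Omega K A →ₗ[K] TripleTensor K A :=
    (TensorProduct.assoc K A A A).toLinearMap ∘ₗ
      (TensorProduct.mk K (A ⊗[K] A) A).flip 1 ∘ₗ Omega.incl K A
  have hs : g ∘ₗ s = LinearMap.id := by
    refine LinearMap.ext fun t => Omega.incl_injective ?_
    have h1 : ∀ w : A ⊗[K] A, barDiff K A (TensorProduct.assoc K A A A (w ⊗ₜ[K] 1)) =
        w - LinearMap.mul' K A w ⊗ₜ 1 := by
      intro w
      induction w with
      | zero => simp
      | add v w hv hw => simp only [TensorProduct.add_tmul, map_add, hv, hw]; abel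
      | tmul x y => simp
    have h2 : LinearMap.mul' K A (Omega.incl K A t) = 0 := t.2
    rw [LinearMap.comp_apply, hgi]
    exact (h1 _).trans (by rw [h2, TensorProduct.zero_tmul, sub_zero]; rfl)
  have hg : IsBimoduleHom A g := by
    constructor
    · intro a m
      apply Omega.incl_injective
      rw [hgi, Omega.incl_smul, hgi, TripleTensor.smul_def]
      have : barDiff K A ∘ₗ leftMulTriple K A a =
          (LinearMap.mulLeft K a).rTensor A ∘ₗ barDiff K A := by
        ext x y z; simp [mul_assoc]
      exact DFunLike.congr_fun this m
    · intro a m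
      apply Omega.incl_injective
      rw [hgi, Omega.incl_op_smul, hgi, TripleTensor.op_smul_def]
      have : barDiff K A ∘ₗ rightMulTriple K A a.unop =
          (LinearMap.mulRight K a.unop).lTensor A ∘ₗ barDiff K A := by
        ext x y z; simp [mul_assoc]
      exact DFunLike.congr_fun this m
  -- Lifting the identity of `Ω¹A` gives a bimodule splitting of the bar differential; composed with
  -- the universal derivation it is `D`.
  obtain ⟨f, hf, hgf⟩ := h (TripleTensor K A) (Omega K A) g hg ⟨s, hs⟩ LinearMap.id
    ⟨fun _ _ => rfl, fun _ _ => rfl⟩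
  let d₀ : A →ₗ[K] A ⊗[K] A :=
    TensorProduct.mk K A A 1 - (TensorProduct.mk K A A).flip 1
  let d : A →ₗ[K] Omega K A := d₀.codRestrict _ fun a => by simp [d₀]
  have hd : ∀ a, Omega.incl K A (d a) = 1 ⊗ₜ a - a ⊗ₜ 1 := fun _ => rfl
  have hder : ∀ a b, d (a * b) = a • d b + MulOpposite.op b • d a := by
    intro a b
    apply Omega.incl_injective
    simp [hd, Omega.incl_smul, Omega.incl_op_smul]
  refine ⟨f ∘ₗ d, fun a b => ?_, fun a => ?_⟩
  · exact (congrArg f (hder a b)).trans ((map_add f _ _).trans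
      (congrArg₂ _ (hf.map_smul a (d b)) (hf.map_op_smul _ (d a))))
  · have := DFunLike.congr_fun hgf (d a)
    rw [← hd, ← LinearMap.id_apply (R := K) (d a), ← this]
    rfl

/-! ### Newton's iteration for splittings -/

variable {K} {E : Type*} [Ring E] [Algebra K E]

/-- The failure `x ⊗ y ↦ σ(xy) - σ(x)σ(y)` of `σ` to be multiplicative. -/
noncomputable def curvature (σ : A →ₗ[K] E) : A ⊗[K] A →ₗ[K] E :=
  σ ∘ₗ LinearMap.mul' K A - LinearMap.mul' K E ∘ₗ TensorProduct.map σ σ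

@[simp] theorem curvature_tmul (σ : A →ₗ[K] E) (x y : A) :
    curvature σ (x ⊗ₜ y) = σ (x * y) - σ x * σ y := by
  simp [curvature]

/-- If the curvature of `σ` takes values in `V`, then `σ` can be modified by a map with values in
`V` so that its curvature takes values in `I * V`. -/
theorem exists_newton_step {D : A →ₗ[K] A ⊗[K] (A ⊗[K] A)}
    (hD : ∀ a b, D (a * b) = leftMulTriple K A a (D b) + rightMulTriple K A b (D a))
    (hDd : ∀ a, barDiff K A (D a) = 1 ⊗ₜ a - a ⊗ₜ 1) {I V : Submodule K E}
    (hVI : V ≤ I) (hV : ∀ (x : E), ∀ v ∈ V, x * v ∈ V) {σ : A →ₗ[K] E} (h1 : σ 1 = 1)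
    (hσ : ∀ a b, σ (a * b) - σ a * σ b ∈ V) :
    ∃ σ' : A →ₗ[K] E, σ' 1 = 1 ∧ (∀ a, σ' a - σ a ∈ V) ∧
      ∀ a b, σ' (a * b) - σ' a * σ' b ∈ I * V := by
  -- `G(x ⊗ y ⊗ z) = σ(x) c(y, z)`, with `c` the curvature. Modulo `I * V` it is left linear through
  -- `σ`, and fails to be right linear exactly by `σ ⊗ c(-, b)` applied to the bar differential;
  -- both defects are products of two curvatures.
  let G : A ⊗[K] (A ⊗[K] A) →ₗ[K] E := LinearMap.mul' K E ∘ₗ TensorProduct.map σ (curvature σ)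
  have hG : ∀ x y z, G (x ⊗ₜ (y ⊗ₜ z)) = σ x * (σ (y * z) - σ y * σ z) := fun x y z => by
    simp [G]
  have hGV : ∀ t, G t ∈ V := by
    intro t
    induction t with
    | zero => simp
    | add s t hs ht => rw [map_add]; exact add_mem hs ht
    | tmul x w =>
      induction w with
      | zero => simp
      | add s t hs ht => rw [TensorProduct.tmul_add, map_add]; exact add_mem hs ht
      | tmul y z => rw [hG]; exact hV _ _ (hσ y z)
  have hGl : ∀ a t, G (leftMulTriple K A a t) - σ a * G t ∈ I * V := by
    intro a t
    let F : A ⊗[K] (A ⊗[K] A) →ₗ[K] E := G ∘ₗ leftMulTriple K A a - LinearMap.mulLeft K (σ a) ∘ₗ G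
    change F t ∈ I * V
    induction t with
    | zero => simp
    | add s t hs ht => rw [map_add]; exact add_mem hs ht
    | tmul x w =>
      induction w with
      | zero => simp
      | add s t hs ht => rw [TensorProduct.tmul_add, map_add]; exact add_mem hs ht
      | tmul y z =>
        convert Submodule.mul_mem_mul (hVI (hσ a x)) (hσ y z) using 1
        simp only [F, LinearMap.sub_apply, LinearMap.comp_apply, leftMulTriple_tmul, hG,
          LinearMap.mulLeft_apply]
        noncomm_ring
  have hGr : ∀ b t, G (rightMulTriple K A b t) - G t * σ b -
      (LinearMap.mul' K E ∘ₗ TensorProduct.map σ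
        (curvature σ ∘ₗ (TensorProduct.mk K A A).flip b)) (barDiff K A t) ∈ I * V := by
    intro b t
    let F : A ⊗[K] (A ⊗[K] A) →ₗ[K] E := G ∘ₗ rightMulTriple K A b -
      LinearMap.mulRight K (σ b) ∘ₗ G - (LinearMap.mul' K E ∘ₗ TensorProduct.map σ
        (curvature σ ∘ₗ (TensorProduct.mk K A A).flip b)) ∘ₗ barDiff K A
    change F t ∈ I * V
    induction t with
    | zero => simp
    | add s t hs ht => rw [map_add]; exact add_mem hs ht
    | tmul x w =>
      induction w with
      | zero => simp
      | add s t hs ht => rw [TensorProduct.tmul_add, map_add]; exact add_mem hs ht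
      | tmul y z =>
        convert Submodule.mul_mem_mul (hVI (hσ x y)) (hσ z b) using 1
        simp only [F, LinearMap.sub_apply, LinearMap.comp_apply, rightMulTriple_tmul, hG,
          LinearMap.mulRight_apply, barDiff_tmul, map_sub, TensorProduct.map_tmul,
          LinearMap.mul'_apply, LinearMap.flip_apply, TensorProduct.mk_apply, curvature_tmul,
          mul_assoc]
        noncomm_ring
  have hD1 : D 1 = 0 := by
    have h := hD 1 1
    have hl : leftMulTriple K A (1 : A) (D 1) = D 1 := by
      rw [leftMulTriple, LinearMap.mulLeft_one, LinearMap.rTensor_id, LinearMap.id_apply]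
    have hr : rightMulTriple K A (1 : A) (D 1) = D 1 := by
      rw [rightMulTriple, LinearMap.mulRight_one, LinearMap.lTensor_id, LinearMap.lTensor_id,
        LinearMap.id_apply]
    rw [hl, hr, mul_one] at h
    exact left_eq_add.1 h
  -- As `D` lifts `1 ⊗ a - a ⊗ 1`, the right defect at `D a` is `σ(1) c(a, b) - σ(a) c(1, b) = c(a,
  -- b)`, since `σ` is unital. So subtracting `G ∘ D` cancels the curvature to first order; the
  -- remainder includes the product `G(D a) G(D b)`.
  refine ⟨σ - G ∘ₗ D, by simp [h1, hD1], fun a => by simpa using hGV (D a), fun a b => ?_⟩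
  have h2 := hGl a (D b)
  have h3 := hGr b (D a)
  have h4 := Submodule.mul_mem_mul (hVI (hGV (D a))) (hGV (D b))
  rw [hDd] at h3
  simp only [LinearMap.comp_apply, map_sub, TensorProduct.map_tmul,
    LinearMap.mul'_apply, LinearMap.flip_apply, TensorProduct.mk_apply, curvature_tmul, h1,
    one_mul, sub_self, mul_zero, sub_zero] at h3
  convert neg_mem (add_mem (add_mem h2 h3) h4) using 1
  simp only [LinearMap.sub_apply, LinearMap.comp_apply, hD, map_add]
  noncomm_ring

end Bar
end HopfSplit

namespace HopfSplit

/-! ### The invariant form of an integral, and the co-opposite bialgebra -/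

section Integral

universe u v
variable {K : Type u} {H : Type v} [Field K] [Ring H] [HopfAlgebra K H]

open Coalgebra HopfAlgebra

/-- `Δ(S(h₁)) (h₂ ⊗ 1) = 1 ⊗ S(h)`. -/
theorem comul_antipode_mul_tmul_one (h : H) :
    LinearMap.mul' K (H ⊗[K] H) (TensorProduct.map (comul ∘ₗ antipode K)
      ((TensorProduct.mk K H H).flip 1) (comul (R := K) h)) = 1 ⊗ₜ antipode K h := by
  -- In the convolution algebra of maps `H → H ⊗ H`, `Δ = i₁ * i₂`, with left inverse `Δ ∘ S`, and
  -- `iS` is a right inverse of `i₂`. Hence `(Δ ∘ S) * i₁ = iS`.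
  let i₁ : WithConv (H →ₗ[K] H ⊗[K] H) := WithConv.toConv ((TensorProduct.mk K H H).flip 1)
  let i₂ : WithConv (H →ₗ[K] H ⊗[K] H) := WithConv.toConv (TensorProduct.mk K H H 1)
  let d : WithConv (H →ₗ[K] H ⊗[K] H) := WithConv.toConv comul
  let dS : WithConv (H →ₗ[K] H ⊗[K] H) := WithConv.toConv (comul ∘ₗ antipode K)
  let iS : WithConv (H →ₗ[K] H ⊗[K] H) := WithConv.toConv (TensorProduct.mk K H H 1 ∘ₗ antipode K)
  have h1 : i₁ * i₂ = d := by
    ext x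
    simp only [LinearMap.convMul_apply, i₁, i₂, d]
    induction comul (R := K) x with
    | zero => simp
    | add s t hs ht => simp only [map_add, hs, ht]
    | tmul a b => simp
  have h2 : i₂ * iS = 1 := by
    ext x
    simp only [LinearMap.convMul_apply, LinearMap.convOne_apply, i₂, iS]
    have : ∀ t : H ⊗[K] H, LinearMap.mul' K (H ⊗[K] H) (TensorProduct.map (TensorProduct.mk K H H 1)
      (TensorProduct.mk K H H 1 ∘ₗ antipode K) t) =
        1 ⊗ₜ LinearMap.mul' K H ((antipode K).lTensor H t) := by
      intro t
      induction t with
      | zero => simp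
      | add s t hs ht => simp only [map_add, hs, ht, TensorProduct.tmul_add]
      | tmul a b => simp
    refine (this _).trans ?_
    rw [mul_antipode_lTensor_comul_apply, Algebra.algebraMap_eq_smul_one,
      Algebra.algebraMap_eq_smul_one, TensorProduct.tmul_smul, Algebra.TensorProduct.one_def]
  have h3 : dS * d = 1 := by
    ext x
    simp only [LinearMap.convMul_apply, LinearMap.convOne_apply, dS, d]
    have : ∀ t : H ⊗[K] H, LinearMap.mul' K (H ⊗[K] H)
      (TensorProduct.map (comul ∘ₗ antipode K) comul t) =
        comul (LinearMap.mul' K H ((antipode K).rTensor H t)) := by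
      intro t
      induction t with
      | zero => simp
      | add s t hs ht => simp only [map_add, hs, ht]
      | tmul a b => simp
    refine (this _).trans ?_
    rw [mul_antipode_rTensor_comul_apply, Bialgebra.comul_algebraMap]
  have h4 : dS * i₁ = iS := by
    calc dS * i₁ = dS * (i₁ * i₂) * iS := by rw [mul_assoc, mul_assoc, h2, mul_one]
      _ = iS := by rw [h1, h3, one_mul]
  exact DFunLike.congr_fun (congrArg WithConv.ofConv h4) h

/-- The form `g ⊗ h ↦ λ(g S(h))`. -/
noncomputable def integralForm (lam : H →ₗ[K] K) : H ⊗[K] H →ₗ[K] K :=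
  lam ∘ₗ LinearMap.mul' K H ∘ₗ (antipode K).lTensor H

@[simp] theorem integralForm_tmul (lam : H →ₗ[K] K) (g h : H) :
    integralForm lam (g ⊗ₜ h) = lam (g * antipode K h) := rfl

/-- Each property of `λ` has its role. Coseparability, `g₁ λ(g₂ S(h)) = λ(g S(h₁)) h₂`, comes from
the integral property applied to `g S(h₁)`, after writing `1 ⊗ S(h)` as `Δ(S(h₁)) (h₂ ⊗ 1)`.
Normalization gives `θ ∘ Δ = ε`, and `ad`-invariance gives left invariance. Right invariance needs
only the antipode: `g a₁ S(a₂) S(h) = ε(a) g S(h)`. -/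
theorem isInvariantForm_integralForm {lam : H →ₗ[K] K} (hl : IsAdInvariantIntegral K lam) :
    IsInvariantForm (Bialgebra.comulAlgHom K H) counit (integralForm lam) where
  cosep g h := by
    let P : H ⊗[K] H →ₗ[K] H := (TensorProduct.rid K H).toLinearMap ∘ₗ lam.lTensor H
    have hP : ∀ x : H, P (comul x) = lam x • (1 : H) := hl.left_integral
    have hPr : ∀ (t : H ⊗[K] H) (a : H), P (t * a ⊗ₜ 1) = P t * a := by
      intro t a
      induction t with
      | zero => simp
      | add s t hs ht => simp only [add_mul, map_add, hs, ht]
      | tmul x y => simp [P]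
    have hleft : ∀ t : H ⊗[K] H, TensorProduct.rid K H ((integralForm lam ∘ₗ
        (TensorProduct.mk K H H).flip h).lTensor H t) = P (t * 1 ⊗ₜ antipode K h) := by
      intro t
      induction t with
      | zero => simp
      | add s t hs ht => simp only [add_mul, map_add, hs, ht]
      | tmul x y => simp [P]
    have hright : ∀ t : H ⊗[K] H, TensorProduct.lid K H ((integralForm lam ∘ₗ
        TensorProduct.mk K H H g).rTensor H t) = P (comul g * LinearMap.mul' K (H ⊗[K] H)
          (TensorProduct.map (comul ∘ₗ antipode K) ((TensorProduct.mk K H H).flip 1) t)) := by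
      intro t
      induction t with
      | zero => simp
      | add s t hs ht => simp only [mul_add, map_add, hs, ht]
      | tmul x y => simp [← mul_assoc, hPr, ← Bialgebra.comul_mul, hP]
    rw [hleft, hright]
    exact congrArg (fun t => P (comul g * t)) (comul_antipode_mul_tmul_one h).symm
  comul h := by
    change lam (LinearMap.mul' K H ((antipode K).lTensor H (comul h))) = counit h
    rw [mul_antipode_lTensor_comul_apply, Algebra.algebraMap_eq_smul_one, map_smul, hl.map_one,
      smul_eq_mul, mul_one]
  comul_mul a t := by
    induction t with
    | zero => simp
    | add s t hs ht => simp only [mul_add, map_add, hs, ht]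
    | tmul g h =>
      rw [integralForm_tmul, ← hl.ad_invariant, Bialgebra.comulAlgHom_apply]
      induction comul (R := K) a with
      | zero => simp
      | add s t hs ht => simp only [add_mul, map_add, hs, ht]
      | tmul x y => simp [antipode_mul_antidistrib, mul_assoc]
  mul_comul t a := by
    induction t with
    | zero => simp
    | add s t hs ht => simp only [add_mul, map_add, hs, ht]
    | tmul g h =>
      have h1 : ∀ w : H ⊗[K] H, integralForm lam (g ⊗ₜ h * w) =
          lam (g * LinearMap.mul' K H ((antipode K).lTensor H w) * antipode K h) := by
        intro w
        induction w with
        | zero => simp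
        | add s t hs ht => simp only [mul_add, add_mul, map_add, hs, ht]
        | tmul x y => simp [antipode_mul_antidistrib, mul_assoc]
      rw [h1, Bialgebra.comulAlgHom_apply, mul_antipode_lTensor_comul_apply,
        Algebra.algebraMap_eq_smul_one]
      simp [mul_comm]

theorem isAlgCoaction_comul : IsAlgCoaction (Bialgebra.comulAlgHom K H) counit
    (Bialgebra.comulAlgHom K H) where
  coassoc := coassoc_apply
  counit x := by simp

/-- The comultiplication of the co-opposite bialgebra. -/
noncomputable def comulCop (K : Type u) (H : Type v) [Field K] [Ring H] [HopfAlgebra K H] :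
    H →ₐ[K] H ⊗[K] H :=
  (Algebra.TensorProduct.comm K H H).toAlgHom.comp (Bialgebra.comulAlgHom K H)

theorem toLinearMap_comulCop : (comulCop K H).toLinearMap =
    (TensorProduct.comm K H H).toLinearMap ∘ₗ comul := rfl

theorem comulCop_apply (h : H) : comulCop K H h = TensorProduct.comm K H H (comul h) := rfl

theorem comm_comulCop (h : H) :
    Algebra.TensorProduct.comm K H H (comulCop K H h) = comul h :=
  (TensorProduct.comm K H H).symm_apply_apply (comul h)

/-- The flip is an algebra isomorphism and exchanges the two sides of coseparability. No antipode
for the co-opposite is needed, hence no bijectivity of `S`. -/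
theorem IsInvariantForm.cop {θ : H ⊗[K] H →ₗ[K] K}
    (hθ : IsInvariantForm (Bialgebra.comulAlgHom K H) counit θ) :
    IsInvariantForm (comulCop K H) counit (θ ∘ₗ (TensorProduct.comm K H H).toLinearMap) where
  cosep g h := by
    have hl : ∀ t : H ⊗[K] H, TensorProduct.rid K H (((θ ∘ₗ (TensorProduct.comm K H H).toLinearMap)
        ∘ₗ (TensorProduct.mk K H H).flip h).lTensor H (TensorProduct.comm K H H t)) =
        TensorProduct.lid K H ((θ ∘ₗ TensorProduct.mk K H H h).rTensor H t) := by
      intro t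
      induction t with
      | zero => simp
      | add s t hs ht => simp only [map_add, hs, ht]
      | tmul x y => simp
    have hr : ∀ t : H ⊗[K] H, TensorProduct.lid K H (((θ ∘ₗ (TensorProduct.comm K H H).toLinearMap)
        ∘ₗ TensorProduct.mk K H H g).rTensor H (TensorProduct.comm K H H t)) =
        TensorProduct.rid K H ((θ ∘ₗ (TensorProduct.mk K H H).flip g).lTensor H t) := by
      intro t
      induction t with
      | zero => simp
      | add s t hs ht => simp only [map_add, hs, ht]
      | tmul x y => simp
    rw [comulCop_apply, comulCop_apply, hl, hr]
    exact (hθ.cosep h g).symm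
  comul h := by
    simpa [comulCop_apply] using hθ.comul h
  comul_mul a t := by
    have h := map_mul (Algebra.TensorProduct.comm K H H) (comulCop K H a) t
    rw [comm_comulCop] at h
    exact (congrArg θ h).trans (hθ.comul_mul a _)
  mul_comul t a := by
    have h := map_mul (Algebra.TensorProduct.comm K H H) t (comulCop K H a)
    rw [comm_comulCop] at h
    exact (congrArg θ h).trans (hθ.mul_comul _ a)

variable {M : Type*} [AddCommGroup M] [Module K M]

/-- Coassociativity of a left coaction, read as a right coaction of the co-opposite. -/
theorem coassoc_comm {d : H →ₗ[K] H ⊗[K] H} {δ : M →ₗ[K] H ⊗[K] M}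
    (hδ : δ.lTensor H ∘ₗ δ = (TensorProduct.assoc K H H M).toLinearMap ∘ₗ d.rTensor M ∘ₗ δ)
    (x : M) :
    TensorProduct.assoc K M H H (((TensorProduct.comm K H M).toLinearMap ∘ₗ δ).rTensor H
      (TensorProduct.comm K H M (δ x))) =
    ((TensorProduct.comm K H H).toLinearMap ∘ₗ d).lTensor M (TensorProduct.comm K H M (δ x)) := by
  let R : H ⊗[K] (H ⊗[K] M) →ₗ[K] M ⊗[K] (H ⊗[K] H) :=
    (TensorProduct.assoc K M H H).toLinearMap ∘ₗ (TensorProduct.comm K H M).toLinearMap.rTensor H ∘ₗ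
      (TensorProduct.comm K H (H ⊗[K] M)).toLinearMap
  have h1 : ∀ t : H ⊗[K] M, TensorProduct.assoc K M H H
      (((TensorProduct.comm K H M).toLinearMap ∘ₗ δ).rTensor H (TensorProduct.comm K H M t)) =
      R (δ.lTensor H t) := by
    intro t
    induction t with
    | zero => simp
    | add s t hs ht => simp only [map_add, hs, ht]
    | tmul a m => simp [R]
  have h2 : ∀ t : H ⊗[K] M, ((TensorProduct.comm K H H).toLinearMap ∘ₗ d).lTensor M
      (TensorProduct.comm K H M t) = R (TensorProduct.assoc K H H M (d.rTensor M t)) := by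
    intro t
    induction t with
    | zero => simp
    | add s t hs ht => simp only [map_add, hs, ht]
    | tmul a m =>
      simp only [TensorProduct.comm_tmul, LinearMap.lTensor_tmul, LinearMap.rTensor_tmul,
        LinearMap.comp_apply, LinearEquiv.coe_coe]
      induction d a with
      | zero => simp
      | add s t hs ht =>
        simp only [map_add, TensorProduct.tmul_add, TensorProduct.add_tmul, hs, ht]
      | tmul a b => simp [R]
  rw [h1, h2]
  exact congrArg R (DFunLike.congr_fun hδ x)

theorem counit_comm {δ : M →ₗ[K] H ⊗[K] M} (hδ : (TensorProduct.lid K M).toLinearMap ∘ₗ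
    (counit (R := K) (A := H)).rTensor M ∘ₗ δ = LinearMap.id) (x : M) :
    TensorProduct.rid K M ((counit (R := K) (A := H)).lTensor M
      (TensorProduct.comm K H M (δ x))) = x := by
  have h1 : ∀ t : H ⊗[K] M, TensorProduct.rid K M ((counit (R := K) (A := H)).lTensor M
      (TensorProduct.comm K H M t)) =
      TensorProduct.lid K M ((counit (R := K) (A := H)).rTensor M t) := by
    intro t
    induction t with
    | zero => simp
    | add s t hs ht => simp only [map_add, hs, ht]
    | tmul a m => simp
  rw [h1]
  exact DFunLike.congr_fun hδ x

theorem isAlgCoaction_comulCop : IsAlgCoaction (comulCop K H) counit (comulCop K H) where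
  coassoc x := by
    rw [toLinearMap_comulCop, comulCop_apply]
    exact coassoc_comm (M := H) (d := comul (R := K) (A := H)) (δ := comul (R := K) (A := H))
      (LinearMap.ext fun y => (coassoc_apply y).symm) x
  counit x := by
    rw [comulCop_apply]
    exact counit_comm (M := H) (δ := comul (R := K) (A := H)) (LinearMap.ext fun y => by simp) x

end Integral
end HopfSplit

namespace HopfSplit

/-! ### Averaging in the presence of a second, commuting coaction -/

section Commuting

variable {K H E : Type*} [Field K] [Ring H] [Algebra K H] [Ring E] [Algebra K E]
  {Δ : H →ₐ[K] H ⊗[K] H} {θ : H ⊗[K] H →ₗ[K] K} {ρ : E →ₐ[K] E ⊗[K] H}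

/-- The retraction of `ρ` is colinear for every coaction that commutes with `ρ`. -/
theorem commuting_coaction_retraction {r : E →ₗ[K] E ⊗[K] H}
    (hr : ∀ x, r.rTensor H (ρ x) = TensorProduct.rightComm K E H H
      (ρ.toLinearMap.rTensor H (r x))) (t : E ⊗[K] H) :
    r (retraction θ ρ t) = (retraction θ ρ).rTensor H
      (TensorProduct.rightComm K E H H (r.rTensor H t)) := by
  induction t with
  | zero => simp
  | add s t hs ht => simp only [map_add, hs, ht]
  | tmul n h =>
    have h1 : ∀ (φ : H →ₗ[K] K) (y : E ⊗[K] H), r (TensorProduct.rid K E (φ.lTensor E y)) =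
        TensorProduct.rid K (E ⊗[K] H) (φ.lTensor (E ⊗[K] H) (r.rTensor H y)) := by
      intro φ y
      induction y with
      | zero => simp
      | add y z hy hz => simp only [map_add, hy, hz]
      | tmul e a => simp
    rw [retraction_tmul, h1, hr, LinearMap.rTensor_tmul]
    induction r n with
    | zero => simp
    | add y z hy hz => simp only [TensorProduct.add_tmul, map_add, hy, hz]
    | tmul e a =>
      rw [TensorProduct.rightComm_tmul, LinearMap.rTensor_tmul, LinearMap.rTensor_tmul,
        retraction_tmul, AlgHom.toLinearMap_apply]
      induction ρ e with
      | zero => simp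
      | add y z hy hz => simp only [TensorProduct.add_tmul, map_add, hy, hz]
      | tmul e b => simp [TensorProduct.smul_tmul']

/-- This is what allows averaging twice: averaging along `ρ` does not destroy colinearity for a
coaction commuting with `ρ`. -/
theorem commuting_coaction_average {r : E →ₗ[K] E ⊗[K] H} {d : H →ₗ[K] H ⊗[K] H}
    (hr : ∀ x, r.rTensor H (ρ x) = TensorProduct.rightComm K E H H
      (ρ.toLinearMap.rTensor H (r x)))
    (hd : ∀ x, d.rTensor H (Δ x) = TensorProduct.rightComm K H H H
      (Δ.toLinearMap.rTensor H (d x)))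
    {f : H →ₗ[K] E} (hf : ∀ h, r (f h) = f.rTensor H (d h)) (h : H) :
    r (average Δ θ ρ f h) = (average Δ θ ρ f).rTensor H (d h) := by
  have h1 : ∀ t : H ⊗[K] H, TensorProduct.rightComm K E H H (r.rTensor H (f.rTensor H t)) =
      (f.rTensor H).rTensor H (TensorProduct.rightComm K H H H (d.rTensor H t)) := by
    intro t
    induction t with
    | zero => simp
    | add s t hs ht => simp only [map_add, hs, ht]
    | tmul a b =>
      simp only [LinearMap.rTensor_tmul, hf]
      induction d a with
      | zero => simp
      | add y z hy hz => simp only [TensorProduct.add_tmul, map_add, hy, hz]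
      | tmul c e => simp
  have h2 : ∀ t : (H ⊗[K] H) ⊗[K] H, TensorProduct.rightComm K H H H
      (TensorProduct.rightComm K H H H t) = t := fun t =>
    (TensorProduct.rightComm K H H H).symm_apply_apply t
  rw [average_apply, commuting_coaction_retraction hr, h1, hd, h2]
  simp only [average, LinearMap.rTensor_comp, LinearMap.comp_apply]

end Commuting

/-! ### Powers of the kernel and the iteration -/

section Iteration

variable {K H E : Type*} [Field K] [Ring H] [Algebra K H] [Ring E] [Algebra K E]

/-- The leftmost factor absorbs `x`, as the kernel is an ideal. The exponent must be positive: the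
zeroth power is `K · 1`. -/
theorem mul_mem_ker_pow (π : E →ₐ[K] H) (k : ℕ) (x : E) {v : E}
    (hv : v ∈ LinearMap.ker π.toLinearMap ^ (k + 1)) :
    x * v ∈ LinearMap.ker π.toLinearMap ^ (k + 1) := by
  have h : (⊤ : Submodule K E) * LinearMap.ker π.toLinearMap ≤ LinearMap.ker π.toLinearMap := by
    refine Submodule.mul_le.2 fun y _ z hz => ?_
    have hz' : π z = 0 := hz
    simp [hz']
  rw [pow_succ'] at hv ⊢
  exact mul_le_mul_left h _ (by
    rw [mul_assoc]; exact Submodule.mul_mem_mul Submodule.mem_top hv)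

theorem ker_pow_succ_le (π : E →ₐ[K] H) (k : ℕ) :
    LinearMap.ker π.toLinearMap ^ (k + 1) ≤ LinearMap.ker π.toLinearMap := by
  induction k with
  | zero => rw [zero_add, pow_one]
  | succ k ih =>
    rw [pow_succ]
    refine Submodule.mul_le.2 fun y _ z hz => ?_
    have hz' : π z = 0 := hz
    simp [hz']

theorem ker_pow_mul_self_le (π : E →ₐ[K] H) (k : ℕ) :
    LinearMap.ker π.toLinearMap ^ (k + 1) * LinearMap.ker π.toLinearMap ^ (k + 1) ≤
      LinearMap.ker π.toLinearMap ^ (k + 2) := by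
  rw [pow_succ' _ (k + 1)]
  exact mul_le_mul_left (ker_pow_succ_le π k) _

/-- A unital linear section with property `P` can be improved to an algebra section with property
`P`, if every correction of it can be averaged to have property `P`. -/
theorem exists_algHom_section {D : H →ₗ[K] H ⊗[K] (H ⊗[K] H)}
    (hD : ∀ a b, D (a * b) = leftMulTriple K H a (D b) + rightMulTriple K H b (D a))
    (hDd : ∀ a, barDiff K H (D a) = 1 ⊗ₜ a - a ⊗ₜ 1) (π : E →ₐ[K] H)
    (hnil : IsNilpotent (LinearMap.ker π.toLinearMap)) (P : (H →ₗ[K] E) → Prop)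
    (hP : ∃ σ : H →ₗ[K] E, P σ ∧ σ 1 = 1 ∧ ∀ h, π (σ h) = h)
    (hav : ∀ (k : ℕ) (σ f : H →ₗ[K] E), P σ → f 1 = 1 →
      (∀ h, f h - σ h ∈ LinearMap.ker π.toLinearMap ^ (k + 1)) →
      (∀ a b, f (a * b) - f a * f b ∈ LinearMap.ker π.toLinearMap ^ (k + 2)) →
      ∃ τ : H →ₗ[K] E, P τ ∧ τ 1 = 1 ∧
        (∀ h, τ h - σ h ∈ LinearMap.ker π.toLinearMap ^ (k + 1)) ∧
        ∀ a b, τ (a * b) - τ a * τ b ∈ LinearMap.ker π.toLinearMap ^ (k + 2)) :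
    ∃ σ : H →ₐ[K] E, π.comp σ = AlgHom.id K H ∧ P σ.toLinearMap := by
  have key : ∀ k : ℕ, ∃ σ : H →ₗ[K] E, P σ ∧ σ 1 = 1 ∧ (∀ h, π (σ h) = h) ∧
      ∀ a b, σ (a * b) - σ a * σ b ∈ LinearMap.ker π.toLinearMap ^ (k + 1) := by
    intro k
    induction k with
    | zero =>
      obtain ⟨σ, hσ, h1, hπ⟩ := hP
      refine ⟨σ, hσ, h1, hπ, fun a b => ?_⟩
      -- The iteration starts at exponent one: `π ∘ σ = id` is multiplicative, so the curvature lies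
      -- in the kernel.
      simp [hπ]
    | succ k ih =>
      obtain ⟨σ, hσ, h1, hπ, hmul⟩ := ih
      obtain ⟨f, hf1, hfσ, hfmul⟩ := exists_newton_step hD hDd (ker_pow_succ_le π k)
        (fun x v hv => mul_mem_ker_pow π k x hv) h1 hmul
      rw [← pow_succ'] at hfmul
      obtain ⟨τ, hτ, hτ1, hτσ, hτmul⟩ := hav k σ f hσ hf1 hfσ hfmul
      refine ⟨τ, hτ, hτ1, fun h => ?_, hτmul⟩
      have h2 : π (τ h - σ h) = 0 := ker_pow_succ_le π k (hτσ h)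
      rwa [map_sub, hπ, sub_eq_zero] at h2
  obtain ⟨n, hn⟩ := hnil
  obtain ⟨σ, hσ, h1, hπ, hmul⟩ := key n
  have h0 : LinearMap.ker π.toLinearMap ^ (n + 1) = ⊥ := by
    rw [pow_succ, hn, zero_mul, Submodule.zero_eq_bot]
  refine ⟨AlgHom.ofLinearMap σ h1 fun a b => ?_, AlgHom.ext hπ, hσ⟩
  have := hmul a b
  rwa [h0, Submodule.mem_bot, sub_eq_zero] at this

end Iteration

/-! ### From comodule algebras to coactions by algebra maps, and the theorem -/

section Main

open Coalgebra

universe u v w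
variable {K : Type u} {H : Type v} [Field K] [Ring H] [HopfAlgebra K H] {E : Type w} [Ring E]
  [Algebra K E]

theorem exists_unital_linear_section (π : E →ₐ[K] H) (hsurj : Function.Surjective π) :
    ∃ σ : H →ₗ[K] E, σ 1 = 1 ∧ ∀ h, π (σ h) = h := by
  obtain ⟨s, hs⟩ := π.toLinearMap.exists_rightInverse_of_surjective (LinearMap.range_eq_top.2 hsurj)
  have hs' : ∀ h, π (s h) = h := DFunLike.congr_fun hs
  -- The correction term takes values in multiples of `1 - s 1`, which `π` kills, and `ε(1) = 1`
  -- makes the sum unital.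
  exact ⟨s + (counit (R := K) (A := H)).smulRight (1 - s 1), by simp, fun h => by simp [hs']⟩

/-- A right comodule algebra as a coaction by an algebra homomorphism. -/
noncomputable def IsRightComoduleAlgebra.algHom {ρ : E →ₗ[K] E ⊗[K] H}
    (hρ : IsRightComoduleAlgebra ρ) : E →ₐ[K] E ⊗[K] H :=
  AlgHom.ofLinearMap ρ hρ.coact_one hρ.coact_mul

theorem IsRightComoduleAlgebra.isAlgCoaction {ρ : E →ₗ[K] E ⊗[K] H}
    (hρ : IsRightComoduleAlgebra ρ) :
    IsAlgCoaction (Bialgebra.comulAlgHom K H) counit hρ.algHom where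
  coassoc := DFunLike.congr_fun hρ.comodule.coassoc
  counit := DFunLike.congr_fun hρ.comodule.counit

theorem IsBicomoduleAlgebra.right {δ : E →ₗ[K] H ⊗[K] E} {ρ : E →ₗ[K] E ⊗[K] H}
    (h : IsBicomoduleAlgebra δ ρ) : IsRightComoduleAlgebra ρ :=
  ⟨h.bicomodule.right, h.right_coact_mul, h.right_coact_one⟩

/-- The left coaction of a bicomodule algebra as a right coaction of the co-opposite bialgebra. -/
noncomputable def IsBicomoduleAlgebra.leftAlgHom {δ : E →ₗ[K] H ⊗[K] E} {ρ : E →ₗ[K] E ⊗[K] H}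
    (h : IsBicomoduleAlgebra δ ρ) : E →ₐ[K] E ⊗[K] H :=
  (Algebra.TensorProduct.comm K H E).toAlgHom.comp
    (AlgHom.ofLinearMap δ h.left_coact_one h.left_coact_mul)

section Left

variable {δ : E →ₗ[K] H ⊗[K] E} {ρ : E →ₗ[K] E ⊗[K] H} (h : IsBicomoduleAlgebra δ ρ)

theorem IsBicomoduleAlgebra.leftAlgHom_apply (x : E) :
    h.leftAlgHom x = TensorProduct.comm K H E (δ x) := rfl

theorem IsBicomoduleAlgebra.toLinearMap_leftAlgHom :
    h.leftAlgHom.toLinearMap = (TensorProduct.comm K H E).toLinearMap ∘ₗ δ := rfl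

theorem IsBicomoduleAlgebra.isAlgCoaction_left :
    IsAlgCoaction (comulCop K H) counit h.leftAlgHom where
  coassoc x := by
    rw [h.toLinearMap_leftAlgHom, toLinearMap_comulCop, h.leftAlgHom_apply]
    exact coassoc_comm h.bicomodule.left.coassoc x
  counit x := by
    rw [h.leftAlgHom_apply]
    exact counit_comm h.bicomodule.left.counit x

end Left

theorem comm_lTensor {M N : Type*} [AddCommGroup M] [Module K M] [AddCommGroup N] [Module K N]
    (f : M →ₗ[K] N) (t : H ⊗[K] M) :
    TensorProduct.comm K H N (f.lTensor H t) = f.rTensor H (TensorProduct.comm K H M t) := by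
  induction t with
  | zero => simp
  | add s t hs ht => simp only [map_add, hs, ht]
  | tmul a m => simp

theorem isLeftColinear_iff_comm {M N : Type*} [AddCommGroup M] [Module K M] [AddCommGroup N]
    [Module K N] {δM : M →ₗ[K] H ⊗[K] M} {δN : N →ₗ[K] H ⊗[K] N} {f : M →ₗ[K] N} :
    IsLeftColinear δM δN f ↔ ∀ x, TensorProduct.comm K H N (δN (f x)) =
      f.rTensor H (TensorProduct.comm K H M (δM x)) := by
  simp only [← comm_lTensor, EmbeddingLike.apply_eq_iff_eq]
  exact ⟨fun h x => DFunLike.congr_fun h x, fun h => LinearMap.ext h⟩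

/-- Bicomodule compatibility in the form needed for averaging: two right coactions on `M` that
commute up to swapping the two copies of `H`. -/
theorem rightComm_of_bicomodule {M : Type*} [AddCommGroup M] [Module K M] {δ : M →ₗ[K] H ⊗[K] M}
    {ρ : M →ₗ[K] M ⊗[K] H}
    (h : (TensorProduct.assoc K H M H).toLinearMap ∘ₗ δ.rTensor H ∘ₗ ρ = ρ.lTensor H ∘ₗ δ)
    (x : M) : ρ.rTensor H (TensorProduct.comm K H M (δ x)) = TensorProduct.rightComm K M H H
      (((TensorProduct.comm K H M).toLinearMap ∘ₗ δ).rTensor H (ρ x)) := by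
  have h1 : ∀ t : H ⊗[K] M, ρ.rTensor H (TensorProduct.comm K H M t) =
      TensorProduct.comm K H (M ⊗[K] H) (ρ.lTensor H t) := fun t => (comm_lTensor ρ t).symm
  have h2 : ∀ t : M ⊗[K] H, TensorProduct.rightComm K M H H
      (((TensorProduct.comm K H M).toLinearMap ∘ₗ δ).rTensor H t) =
      TensorProduct.comm K H (M ⊗[K] H) (TensorProduct.assoc K H M H (δ.rTensor H t)) := by
    intro t
    induction t with
    | zero => simp
    | add s t hs ht => simp only [map_add, hs, ht]
    | tmul m b =>
      simp only [LinearMap.rTensor_tmul, LinearMap.comp_apply, LinearEquiv.coe_coe]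
      induction δ m with
      | zero => simp
      | add s t hs ht => simp only [map_add, TensorProduct.add_tmul, hs, ht]
      | tmul a n => simp
  rw [h1, h2]
  exact congrArg _ (DFunLike.congr_fun h x).symm

end Main
end HopfSplit

open HopfSplit in
theorem mainTheorem4 {K : Type*} {H : Type*} [Field K] [Ring H] [HopfAlgebra K H]
    (hint : ∃ lam : H →ₗ[K] K, HopfSplit.IsAdInvariantIntegral K lam)
    (hfs : HopfSplit.IsFormallySmooth K H)
    {E : Type*} [Ring E] [Algebra K E] (π : E →ₐ[K] H)
    (hsurj : Function.Surjective π)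
    (hnil : IsNilpotent (LinearMap.ker π.toLinearMap)) :
    (∀ ρ : E →ₗ[K] E ⊗[K] H, HopfSplit.IsRightComoduleAlgebra ρ →
      HopfSplit.IsRightColinear ρ Coalgebra.comul π.toLinearMap →
      ∃ σ : H →ₐ[K] E, π.comp σ = AlgHom.id K H ∧
        HopfSplit.IsRightColinear Coalgebra.comul ρ σ.toLinearMap) ∧
    (∀ (δ : E →ₗ[K] H ⊗[K] E) (ρ : E →ₗ[K] E ⊗[K] H), HopfSplit.IsBicomoduleAlgebra δ ρ →
      HopfSplit.IsLeftColinear δ Coalgebra.comul π.toLinearMap →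
      HopfSplit.IsRightColinear ρ Coalgebra.comul π.toLinearMap →
      ∃ σ : H →ₐ[K] E, π.comp σ = AlgHom.id K H ∧
        HopfSplit.IsLeftColinear Coalgebra.comul δ σ.toLinearMap ∧
        HopfSplit.IsRightColinear Coalgebra.comul ρ σ.toLinearMap) := by
  obtain ⟨lam, hlam⟩ := hint
  obtain ⟨D, hD, hDd⟩ := hfs.exists_derivation
  obtain ⟨s, hs1, hsπ⟩ := exists_unital_linear_section π hsurj
  have hθ := isInvariantForm_integralForm hlam
  have hθc := hθ.cop
  have hΔ := isAlgCoaction_comul (K := K) (H := H)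
  have hΔc := isAlgCoaction_comulCop (K := K) (H := H)
  refine ⟨fun ρ hρ hπρ => ?_, fun δ ρ hE hπδ hπρ => ?_⟩
  · have hr := hρ.isAlgCoaction
    have hI : ∀ n, ∀ x ∈ LinearMap.ker π.toLinearMap ^ n, hρ.algHom x ∈ tensorRight H
        (LinearMap.ker π.toLinearMap ^ n) := coaction_pow_mem
      (coaction_ker_mem (Δ := Bialgebra.comulAlgHom K H) hsurj (DFunLike.congr_fun hπρ))
    refine exists_algHom_section hD hDd π hnil (IsRightColinear Coalgebra.comul ρ)
      ⟨average (Bialgebra.comulAlgHom K H) (integralForm lam) hρ.algHom s,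
        LinearMap.ext (coaction_average hθ hr hΔ s), average_one hθ hr hs1,
        map_average hθ hΔ (DFunLike.congr_fun hπρ) hsπ⟩ fun k σ f hσ hf1 hfσ hf => ?_
    have hσ' := DFunLike.congr_fun hσ
    refine ⟨average (Bialgebra.comulAlgHom K H) (integralForm lam) hρ.algHom f,
      LinearMap.ext (coaction_average hθ hr hΔ f), average_one hθ hr hf1,
      average_sub_mem hθ hr (hI _) hσ' hfσ,
      average_mul_sub_mem hθ hr (hI _) (hI _) (ker_pow_mul_self_le π k) hσ' hfσ hf⟩
  · have hρ := hE.right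
    have hr := hρ.isAlgCoaction
    have hl := hE.isAlgCoaction_left
    have hπδ' := isLeftColinear_iff_comm.1 hπδ
    have hI : ∀ n, ∀ x ∈ LinearMap.ker π.toLinearMap ^ n, hρ.algHom x ∈ tensorRight H
        (LinearMap.ker π.toLinearMap ^ n) := coaction_pow_mem
      (coaction_ker_mem (Δ := Bialgebra.comulAlgHom K H) hsurj (DFunLike.congr_fun hπρ))
    have hIl : ∀ n, ∀ x ∈ LinearMap.ker π.toLinearMap ^ n, hE.leftAlgHom x ∈ tensorRight H
        (LinearMap.ker π.toLinearMap ^ n) := coaction_pow_mem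
      (coaction_ker_mem (Δ := comulCop K H) hsurj hπδ')
    have hcE := rightComm_of_bicomodule hE.bicomodule.comm
    -- For `H` itself, the compatibility of the left and right regular coactions is coassociativity.
    have hcH := rightComm_of_bicomodule (K := K) (H := H) (M := H) (δ := Coalgebra.comul)
      (ρ := Coalgebra.comul) Coalgebra.coassoc
    let avR := average (Bialgebra.comulAlgHom K H) (integralForm lam) hρ.algHom
    let avL := average (comulCop K H)
      (integralForm lam ∘ₗ (TensorProduct.comm K H H).toLinearMap) hE.leftAlgHom
    have havL : ∀ f, IsLeftColinear Coalgebra.comul δ (avL f) := fun f =>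
      isLeftColinear_iff_comm.2 (coaction_average hθc hl hΔc f)
    have havLR : ∀ f, IsRightColinear Coalgebra.comul ρ (avL (avR f)) := fun f =>
      LinearMap.ext (commuting_coaction_average (Δ := comulCop K H) (ρ := hE.leftAlgHom)
        hcE hcH (coaction_average hθ hr hΔ f))
    refine exists_algHom_section hD hDd π hnil
      (fun σ => IsLeftColinear Coalgebra.comul δ σ ∧ IsRightColinear Coalgebra.comul ρ σ)
      ⟨avL (avR s), ⟨havL _, havLR s⟩, average_one hθc hl (average_one hθ hr hs1),
        map_average hθc hΔc hπδ' (map_average hθ hΔ (DFunLike.congr_fun hπρ) hsπ)⟩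
      fun k σ f hσ hf1 hfσ hf => ?_
    have hσl := isLeftColinear_iff_comm.1 hσ.1
    have hσr := DFunLike.congr_fun hσ.2
    -- The right average is still close to `σ`, so the estimate for averaging applies a second time,
    -- now on the left.
    have hσ' := average_sub_mem hθ hr (hI _) hσr hfσ
    exact ⟨avL (avR f), ⟨havL _, havLR f⟩, average_one hθc hl (average_one hθ hr hf1),
      average_sub_mem hθc hl (hIl _) hσl hσ',
      average_mul_sub_mem hθc hl (hIl _) (hIl _) (ker_pow_mul_self_le π k) hσl hσ'
        (average_mul_sub_mem hθ hr (hI _) (hI _) (ker_pow_mul_self_le π k) hσr hfσ hf)⟩
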